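/- Let $M$ be a smooth (finite-dimensional, Hausdorff) manifold and $P$ a Poisson tensor on $M$, viewed as a skew-symmetric bundle map $P:T^*M\to TM$, with $\langle P,\alpha\wedge\beta\rangle=\beta(P\alpha)$. Let $$\mu^P(\alpha,\beta)=[\alpha,\beta]^P=\mathcal L_{P\alpha}\beta-\mathcal L_{P\beta}\alpha-\mathrm d\langle P,\alpha\wedge\beta\rangle$$ be the associated bracket of $1$-forms (the same formula defines $\mu^{Q}$ for any bundle map $Q:T^*M\to TM$). For a bilinear product $\mu$ on the smooth sections of a vector bundle and a smooth endomorphism $N$ of the bundle put $$\delta_N\mu(s,t)=\mu(Ns,t)+\mu(s,Nt)-N\mu(s,t),\qquad T_N\mu(s,t)=\mu(Ns,Nt)-N\,\delta_N\mu(s,t);$$ $N$ is a Nijenhuis tensor for $\mu$ if its Nijenhuis torsion $T_N\mu$ vanishes. Let $N:T^*M\to T^*M$ be a Nijenhuis tensor for $\mu^P$, let ${}^tN:TM\to TM$ be its dual bundle map, and assume $PN={}^tN\,P$. (1) The Nijenhuis torsion $T_{{}^tN}$ of ${}^tN$ with respect to the Lie bracket of vector fields vanishes on vector fields in the image of $P$: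 if $X,Y$ are smooth vector fields with $X_x,Y_x\in P(T_x^*M)$ for all $x\in M$, then $T_{{}^tN}(X,Y)=0$. (2) In particular, if $P$ is invertible (i.e. comes from a symplectic structure) and the contracted bracket $\mu^P_N=\delta_N\mu^P$ equals $\mu^{PN}$, then $(P,{}^tN)$ is a Poisson–Nijenhuis structure, i.e. $P$ is a Poisson tensor, ${}^tN$ is a smooth Nijenhuis tensor for the Lie bracket of vector fields, ${}^tN\,P=P\,N$, and the concomitant $$C(P,{}^tN)(\alpha,\beta)=[\alpha,\beta]^{{}^tN P}-\bigl([N\alpha,\beta]^P+[\alpha,N\beta]^P-N[\alpha,\beta]^P\bigr)$$ vanishes for all smooth $1$-forms $\alpha,\beta$. -/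

import Mathlib

open Bundle VectorField
open scoped Manifold ContDiff

noncomputable section

namespace PoissonContraction

/-! ### Linear algebra: transposes -/

section Transpose

variable {E : Type*} [NormedAddCommGroup E] [NormedSpace ℝ E]

/-- The dual `φ ↦ φ ∘ A` of an endomorphism `A` of `E`, acting on the dual space. -/
def dualMapCLM (A : E →L[ℝ] E) : (E →L[ℝ] ℝ) →L[ℝ] (E →L[ℝ] ℝ) :=
  (ContinuousLinearMap.compL ℝ E E ℝ).flip A

variable [FiniteDimensional ℝ E]

/-- Every endomorphism of the dual of a finite-dimensional space is the dual of a unique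
endomorphism of the space. -/
theorem existsUnique_transpose (B : (E →L[ℝ] ℝ) →L[ℝ] (E →L[ℝ] ℝ)) :
    ∃! A : E →L[ℝ] E, ∀ (φ : E →L[ℝ] ℝ) (v : E), φ (A v) = B φ v := by
  let b := Module.finBasis ℝ E
  let c : Fin (Module.finrank ℝ E) → (E →L[ℝ] ℝ) := fun i =>
    LinearMap.toContinuousLinearMap (b.coord i)
  have hc : ∀ φ : E →L[ℝ] ℝ, φ = ∑ i, φ (b i) • c i := by
    intro φ
    ext v
    conv_lhs => rw [← b.sum_repr v, map_sum]
    simp [c, mul_comm, -Module.Basis.sum_repr]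
  refine ⟨∑ i, (B (c i)).smulRight (b i), ?_, ?_⟩
  · intro φ v
    conv_rhs => rw [hc φ]
    simp [mul_comm]
  · intro A hA
    ext v
    apply b.ext_elem
    intro j
    have h := hA (c j) v
    simp only [c, LinearMap.coe_toContinuousLinearMap', Module.Basis.coord_apply] at h
    rw [h]
    simp [c, Finsupp.single_apply]

/-- The transpose of an endomorphism `B` of the dual of a finite-dimensional space `E`, as an
endomorphism of `E` (through `E = E**`): `φ (ᵗB v) = (B φ) v`. -/
def transposeCLM (B : (E →L[ℝ] ℝ) →L[ℝ] (E →L[ℝ] ℝ)) : E →L[ℝ] E :=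
  (existsUnique_transpose B).choose

theorem apply_transposeCLM (B : (E →L[ℝ] ℝ) →L[ℝ] (E →L[ℝ] ℝ)) (φ : E →L[ℝ] ℝ) (v : E) :
    φ (transposeCLM B v) = B φ v :=
  (existsUnique_transpose B).choose_spec.1 φ v

end Transpose

/-! ### Brackets of sections and Nijenhuis torsion -/

section Torsion

variable {M : Type*} {V : M → Type*} [∀ x, TopologicalSpace (V x)] [∀ x, AddCommGroup (V x)]
  [∀ x, Module ℝ (V x)]

/-- The deformed product `δ_N μ (s, t) = μ(N s, t) + μ(s, N t) - N μ(s, t)` of sections. -/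
def deformedBracket (μ : (Π x, V x) → (Π x, V x) → Π x, V x) (N : Π x, V x →L[ℝ] V x)
    (s t : Π x, V x) (x : M) : V x :=
  μ (fun y => N y (s y)) t x + μ s (fun y => N y (t y)) x - N x (μ s t x)

/-- The Nijenhuis torsion `T_N μ (s, t) = μ(N s, N t) - N (δ_N μ (s, t))`. -/
def nijenhuisTorsion (μ : (Π x, V x) → (Π x, V x) → Π x, V x) (N : Π x, V x →L[ℝ] V x)
    (s t : Π x, V x) (x : M) : V x :=
  μ (fun y => N y (s y)) (fun y => N y (t y)) x - N x (deformedBracket μ N s t x)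

end Torsion

/-! ### Tensor fields on a manifold -/

section Manifold

variable {E : Type*} [NormedAddCommGroup E] [NormedSpace ℝ E]
  {M : Type*} [TopologicalSpace M] [ChartedSpace E M]

/-- The cotangent space `T*_x M`. -/
abbrev Cotangent (E : Type*) [NormedAddCommGroup E] [NormedSpace ℝ E] {M : Type*}
    [TopologicalSpace M] [ChartedSpace E M] (x : M) : Type _ :=
  TangentSpace 𝓘(ℝ, E) x →L[ℝ] ℝ

/-- Differential of a real function, as a 1-form. -/
def differential (f : M → ℝ) (x : M) : Cotangent E x := mvfderiv 𝓘(ℝ, E) f x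

/-- The expression of a 1-form in the preferred chart at `x₀`: its pullback by the inverse of the
chart. -/
def inChart (β : Π x : M, Cotangent E x) (x₀ : M) (y : E) : E →L[ℝ] ℝ :=
  (β ((extChartAt 𝓘(ℝ, E) x₀).symm y)).comp
    (mfderiv 𝓘(ℝ, E) 𝓘(ℝ, E) (extChartAt 𝓘(ℝ, E) x₀).symm y)

/-- Exterior derivative of a 1-form: `extDerivOne β x u = (dβ)_x(u, ·)`, computed in the preferred
chart at `x` by `dβ(u, v) = (D_u β)(v) - (D_v β)(u)`. -/
def extDerivOne (β : Π x : M, Cotangent E x) (x : M) (u : TangentSpace 𝓘(ℝ, E) x) :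
    Cotangent E x :=
  let D : E →L[ℝ] E →L[ℝ] ℝ := fderiv ℝ (inChart β x) (extChartAt 𝓘(ℝ, E) x x)
  let A : TangentSpace 𝓘(ℝ, E) x →L[ℝ] E :=
    mfderiv 𝓘(ℝ, E) 𝓘(ℝ, E) (extChartAt 𝓘(ℝ, E) x) x
  ((D - D.flip) (A u)).comp A

/-- Lie derivative of a 1-form along a vector field: `L_X β = ι_X dβ + d(β(X))`. -/
def lieDeriv (X : Π x : M, TangentSpace 𝓘(ℝ, E) x) (β : Π x : M, Cotangent E x) (x : M) :
    Cotangent E x :=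
  extDerivOne β x (X x) + differential (fun y => β y (X y)) x

/-- The bracket of 1-forms defined by a bivector field `P`, viewed as a bundle map `T*M → TM`:
`[α, β]^P = L_{Pα} β - L_{Pβ} α - d⟨P, α ∧ β⟩`, where `⟨P, α ∧ β⟩ = β(Pα)`. -/
def formBracket (P : Π x : M, Cotangent E x →L[ℝ] TangentSpace 𝓘(ℝ, E) x)
    (α β : Π x : M, Cotangent E x) (x : M) : Cotangent E x :=
  lieDeriv (fun y => P y (α y)) β x - lieDeriv (fun y => P y (β y)) α x
    - differential (fun y => β y (P y (α y))) x

/-- The Poisson bracket of functions `{f, g}^P = ⟨P, df ∧ dg⟩`. -/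
def poissonBracket (P : Π x : M, Cotangent E x →L[ℝ] TangentSpace 𝓘(ℝ, E) x)
    (f g : M → ℝ) (x : M) : ℝ :=
  differential g x (P x (differential f x))

variable [IsManifold 𝓘(ℝ, E) ∞ M]

/-- Smooth vector fields. -/
def SmoothField (X : Π x : M, TangentSpace 𝓘(ℝ, E) x) : Prop :=
  ContMDiff 𝓘(ℝ, E) (𝓘(ℝ, E).prod 𝓘(ℝ, E)) ∞
    (fun x => TotalSpace.mk' E (E := fun x : M => TangentSpace 𝓘(ℝ, E) x) x (X x))

/-- Smooth 1-forms. -/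
def SmoothForm (α : Π x : M, Cotangent E x) : Prop :=
  ContMDiff 𝓘(ℝ, E) (𝓘(ℝ, E).prod 𝓘(ℝ, E →L[ℝ] ℝ)) ∞
    (fun x => TotalSpace.mk' (E →L[ℝ] ℝ) (E := fun x : M => Cotangent E x) x (α x))

/-- Smooth bundle maps `TM → TM`. -/
def SmoothEndTangent (A : Π x : M, TangentSpace 𝓘(ℝ, E) x →L[ℝ] TangentSpace 𝓘(ℝ, E) x) : Prop :=
  ContMDiff 𝓘(ℝ, E) (𝓘(ℝ, E).prod 𝓘(ℝ, E →L[ℝ] E)) ∞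
    (fun x => TotalSpace.mk' (E →L[ℝ] E)
      (E := fun x : M => TangentSpace 𝓘(ℝ, E) x →L[ℝ] TangentSpace 𝓘(ℝ, E) x) x (A x))

/-- Smooth bundle maps `T*M → T*M`. -/
def SmoothEndCotangent (N : Π x : M, Cotangent E x →L[ℝ] Cotangent E x) : Prop :=
  ContMDiff 𝓘(ℝ, E) (𝓘(ℝ, E).prod 𝓘(ℝ, (E →L[ℝ] ℝ) →L[ℝ] (E →L[ℝ] ℝ))) ∞
    (fun x => TotalSpace.mk' ((E →L[ℝ] ℝ) →L[ℝ] (E →L[ℝ] ℝ))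
      (E := fun x : M => Cotangent E x →L[ℝ] Cotangent E x) x (N x))

/-- Smooth bundle maps `T*M → TM`. -/
def SmoothBivectorMap (P : Π x : M, Cotangent E x →L[ℝ] TangentSpace 𝓘(ℝ, E) x) : Prop :=
  ContMDiff 𝓘(ℝ, E) (𝓘(ℝ, E).prod 𝓘(ℝ, (E →L[ℝ] ℝ) →L[ℝ] E)) ∞
    (fun x => TotalSpace.mk' ((E →L[ℝ] ℝ) →L[ℝ] E)
      (E := fun x : M => Cotangent E x →L[ℝ] TangentSpace 𝓘(ℝ, E) x) x (P x))

/-- A Poisson tensor: a smooth skew-symmetric bivector field whose bracket of functions satisfies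
the Jacobi identity. -/
structure IsPoisson (P : Π x : M, Cotangent E x →L[ℝ] TangentSpace 𝓘(ℝ, E) x) : Prop where
  smooth : SmoothBivectorMap P
  skew : ∀ (x : M) (α β : Cotangent E x), β (P x α) = -α (P x β)
  jacobi : ∀ f g h : M → ℝ, ContMDiff 𝓘(ℝ, E) 𝓘(ℝ) ∞ f → ContMDiff 𝓘(ℝ, E) 𝓘(ℝ) ∞ g →
    ContMDiff 𝓘(ℝ, E) 𝓘(ℝ) ∞ h → ∀ x : M,
      poissonBracket P f (poissonBracket P g h) x + poissonBracket P g (poissonBracket P h f) x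
        + poissonBracket P h (poissonBracket P f g) x = 0

/-- `N : T*M → T*M` is a Nijenhuis tensor for the bracket `[·,·]^P` of 1-forms. -/
def IsNijenhuisForForms (P : Π x : M, Cotangent E x →L[ℝ] TangentSpace 𝓘(ℝ, E) x)
    (N : Π x : M, Cotangent E x →L[ℝ] Cotangent E x) : Prop :=
  SmoothEndCotangent N ∧ ∀ α β : Π x : M, Cotangent E x, SmoothForm α → SmoothForm β →
    ∀ x : M, nijenhuisTorsion (formBracket P) N α β x = 0

/-- `A : TM → TM` is a Nijenhuis tensor for the Lie bracket of vector fields. -/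
def IsNijenhuisForFields (A : Π x : M, TangentSpace 𝓘(ℝ, E) x →L[ℝ] TangentSpace 𝓘(ℝ, E) x) :
    Prop :=
  SmoothEndTangent A ∧ ∀ X Y : Π x : M, TangentSpace 𝓘(ℝ, E) x, SmoothField X → SmoothField Y →
    ∀ x : M, nijenhuisTorsion (mlieBracket 𝓘(ℝ, E)) A X Y x = 0

/-- The dual bundle map `T*M → T*M` of `A : TM → TM`. -/
def dualBundleMap (A : Π x : M, TangentSpace 𝓘(ℝ, E) x →L[ℝ] TangentSpace 𝓘(ℝ, E) x) (x : M) :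
    Cotangent E x →L[ℝ] Cotangent E x :=
  dualMapCLM (E := E) (A x)

/-- The dual bundle map `ᵗN : TM → TM` of `N : T*M → T*M`. -/
def transposeBundleMap [FiniteDimensional ℝ E] (N : Π x : M, Cotangent E x →L[ℝ] Cotangent E x)
    (x : M) : TangentSpace 𝓘(ℝ, E) x →L[ℝ] TangentSpace 𝓘(ℝ, E) x :=
  transposeCLM (E := E) (N x)

/-- `(P, A)` is a Poisson–Nijenhuis structure: `P` is a Poisson tensor, `A : TM → TM` is a Nijenhuis
tensor for the Lie bracket of vector fields, `A P = P A*`, and the concomitant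
`C(P, A)(α, β) = [α, β]^{AP} - ([A*α, β]^P + [α, A*β]^P - A*[α, β]^P)` vanishes. -/
structure IsPoissonNijenhuis (P : Π x : M, Cotangent E x →L[ℝ] TangentSpace 𝓘(ℝ, E) x)
    (A : Π x : M, TangentSpace 𝓘(ℝ, E) x →L[ℝ] TangentSpace 𝓘(ℝ, E) x) : Prop where
  poisson : IsPoisson P
  nijenhuis : IsNijenhuisForFields A
  commute : ∀ x : M, (A x).comp (P x) = (P x).comp (dualBundleMap A x)
  concomitant : ∀ α β : Π x : M, Cotangent E x, SmoothForm α → SmoothForm β → ∀ x : M,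
    formBracket (fun y => (A y).comp (P y)) α β x
      - deformedBracket (formBracket P) (dualBundleMap A) α β x = 0

end Manifold

end PoissonContraction

end

/-!
`P` is a morphism from `[·,·]^P` to the Lie bracket of vector fields: the defect
`P [α, β]^P - [P α, P β]` vanishes on exact forms, where it expresses the Jacobi identity of the
Poisson bracket, and it is tensorial. A morphism of brackets which intertwines `N` with `A` carries
the torsion of `N` to that of `A`, so `T_A (P α, P β) = P (T_N (α, β)) = 0`. Finally `T_A` is
tensorial, so only the values of the vector fields at the point matter, and values in the image of
`P` are attained by `P df`.
-/

noncomputable section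

namespace PoissonContraction

open Filter
open scoped Topology

section DifferentiableForms

variable {E : Type*} [NormedAddCommGroup E] [NormedSpace ℝ E]
  {M : Type*} [TopologicalSpace M] [ChartedSpace E M] [IsManifold 𝓘(ℝ, E) ∞ M]
  {β β' : Π x : M, Cotangent E x} {X Y : Π x : M, TangentSpace 𝓘(ℝ, E) x} {f : M → ℝ} {x : M}

/-- Differentiability of a 1-form at a point, as a section of the cotangent bundle. -/
def DifferentiableFormAt (β : Π x : M, Cotangent E x) (x : M) : Prop :=
  MDifferentiableAt 𝓘(ℝ, E) (𝓘(ℝ, E).prod 𝓘(ℝ, E →L[ℝ] ℝ))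
    (fun y => TotalSpace.mk' (E →L[ℝ] ℝ) (E := fun y : M => Cotangent E y) y (β y)) x

theorem SmoothForm.differentiableFormAt (hβ : SmoothForm β) (x : M) : DifferentiableFormAt β x :=
  (hβ x).mdifferentiableAt (by simp)

theorem SmoothField.mdifferentiableAt (hX : SmoothField X) (x : M) : MDiffAt (T% X) x :=
  (hX x).mdifferentiableAt (by simp)

namespace DifferentiableFormAt

theorem add (hβ : DifferentiableFormAt β x) (hβ' : DifferentiableFormAt β' x) :
    DifferentiableFormAt (β + β') x :=
  mdifferentiableAt_add_section (E := fun y : M => Cotangent E y) hβ hβ'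

theorem smul (hf : MDiffAt f x) (hβ : DifferentiableFormAt β x) :
    DifferentiableFormAt (f • β) x :=
  hf.smul_section (E := fun y : M => Cotangent E y) hβ

theorem apply (hβ : DifferentiableFormAt β x) (hX : MDiffAt (T% X) x) :
    MDiffAt (fun y => β y (X y)) x :=
  ((mdifferentiableAt_totalSpace _ _).1
    (MDifferentiableAt.clm_bundle_apply (E₂ := fun _ : M => ℝ) hβ hX)).2

end DifferentiableFormAt

theorem inChart_apply_of_mem_target (β : Π x : M, Cotangent E x) {x : M} {z : E}
    (hz : z ∈ (extChartAt 𝓘(ℝ, E) x).target) :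
    inChart β x z = ContinuousLinearMap.inCoordinates E (TangentSpace 𝓘(ℝ, E)) ℝ (fun _ : M => ℝ)
      x ((extChartAt 𝓘(ℝ, E) x).symm z) x ((extChartAt 𝓘(ℝ, E) x).symm z)
      (β ((extChartAt 𝓘(ℝ, E) x).symm z)) := by
  have hmem : (extChartAt 𝓘(ℝ, E) x).symm z ∈ (chartAt E x).source := by
    simpa only [extChartAt_source] using (extChartAt 𝓘(ℝ, E) x).map_target hz
  have h := TangentBundle.symmL_trivializationAt (I := 𝓘(ℝ, E)) hmem
  rw [(extChartAt 𝓘(ℝ, E) x).right_inv hz, modelWithCornersSelf_coe, Set.range_id,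
    mfderivWithin_univ] at h
  rw [inChart, ContinuousLinearMap.inCoordinates, h]
  ext v
  simp

theorem DifferentiableFormAt.differentiableAt_inChart (hβ : DifferentiableFormAt β x) :
    DifferentiableAt ℝ (inChart β x) (extChartAt 𝓘(ℝ, E) x x) := by
  have h := ((mdifferentiableAt_hom_bundle _).1 hβ).2
  have h' := h.comp_of_eq (x := extChartAt 𝓘(ℝ, E) x x) (f := (extChartAt 𝓘(ℝ, E) x).symm)
    (((contMDiffOn_extChartAt_symm (n := 1) x).contMDiffAt
      (extChartAt_target_mem_nhds x)).mdifferentiableAt one_ne_zero) (extChartAt_to_inv x)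
  refine h'.differentiableAt.congr_of_eventuallyEq ?_
  filter_upwards [extChartAt_target_mem_nhds (I := 𝓘(ℝ, E)) x] with z hz
  exact inChart_apply_of_mem_target β hz

theorem extDerivOne_eq (β : Π x : M, Cotangent E x) (x : M) (u : TangentSpace 𝓘(ℝ, E) x) :
    extDerivOne β x u = (fderiv ℝ (inChart β x) (extChartAt 𝓘(ℝ, E) x x) -
      (fderiv ℝ (inChart β x) (extChartAt 𝓘(ℝ, E) x x)).flip) u := by
  have h : mfderiv 𝓘(ℝ, E) 𝓘(ℝ, E) (extChartAt 𝓘(ℝ, E) x) x = .id ℝ _ := mfderiv_extChartAt_self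
  unfold extDerivOne
  rw [h]
  rfl

theorem extDerivOne_map_add (β : Π x : M, Cotangent E x) (x : M) (u v : TangentSpace 𝓘(ℝ, E) x) :
    extDerivOne β x (u + v) = extDerivOne β x u + extDerivOne β x v := by
  rw [extDerivOne_eq, extDerivOne_eq, extDerivOne_eq]
  exact map_add _ _ _

theorem extDerivOne_map_smul (β : Π x : M, Cotangent E x) (x : M) (c : ℝ)
    (u : TangentSpace 𝓘(ℝ, E) x) :
    extDerivOne β x (c • u) = c • extDerivOne β x u := by
  rw [extDerivOne_eq, extDerivOne_eq]
  exact map_smul _ _ _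

theorem extDerivOne_add (hβ : DifferentiableFormAt β x) (hβ' : DifferentiableFormAt β' x)
    (u : TangentSpace 𝓘(ℝ, E) x) :
    extDerivOne (β + β') x u = extDerivOne β x u + extDerivOne β' x u := by
  have h : fderiv ℝ (inChart (β + β') x) (extChartAt 𝓘(ℝ, E) x x) = _ :=
    fderiv_add hβ.differentiableAt_inChart hβ'.differentiableAt_inChart
  rw [extDerivOne_eq, extDerivOne_eq, extDerivOne_eq, h]
  refine ContinuousLinearMap.ext fun v : E => ?_
  exact add_sub_add_comm _ _ _ _

theorem inChart_extChartAt (β : Π x : M, Cotangent E x) (x : M) :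
    inChart β x (extChartAt 𝓘(ℝ, E) x x) = β x := by
  have h := mfderivWithin_range_extChartAt_symm (I := 𝓘(ℝ, E)) (x := x)
  rw [modelWithCornersSelf_coe, Set.range_id, mfderivWithin_univ] at h
  have h' : ∀ y, y = x → ∀ v : E, β y v = β x v := by rintro y rfl v; rfl
  refine ContinuousLinearMap.ext fun v : E => ?_
  unfold inChart
  rw [h]
  exact h' _ (extChartAt_to_inv x) v

theorem hasFDerivAt_comp_extChartAt_symm {z : E} (hz : z ∈ (extChartAt 𝓘(ℝ, E) x).target)
    (hf : MDiffAt f ((extChartAt 𝓘(ℝ, E) x).symm z)) :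
    HasFDerivAt (f ∘ (extChartAt 𝓘(ℝ, E) x).symm) (inChart (differential f) x z) z := by
  have h : MDiffAt (extChartAt 𝓘(ℝ, E) x).symm z :=
    ((contMDiffOn_extChartAt_symm (n := 1) x).contMDiffAt
      ((isOpen_extChartAt_target x).mem_nhds hz)).mdifferentiableAt one_ne_zero
  exact (hf.hasMFDerivAt.comp z h.hasMFDerivAt).hasFDerivAt

theorem extDerivOne_smul (hf : MDiffAt f x) (hβ : DifferentiableFormAt β x)
    (u : TangentSpace 𝓘(ℝ, E) x) :
    extDerivOne (f • β) x u =
      f x • extDerivOne β x u + differential f x u • β x - β x u • differential f x := by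
  have hf' := hasFDerivAt_comp_extChartAt_symm (E := E) (f := f) (mem_extChartAt_target x)
    (by rwa [extChartAt_to_inv])
  have h : fderiv ℝ (inChart (f • β) x) (extChartAt 𝓘(ℝ, E) x x) = _ :=
    (hf'.fun_smul hβ.differentiableAt_inChart.hasFDerivAt).fderiv
  rw [inChart_extChartAt, inChart_extChartAt, Function.comp_apply, extChartAt_to_inv] at h
  rw [extDerivOne_eq, extDerivOne_eq, h]
  refine ContinuousLinearMap.ext fun v : E => ?_
  set D := fderiv ℝ (inChart β x) (extChartAt 𝓘(ℝ, E) x x)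
  change (f x * D u v + differential f x u * β x v) - (f x * D v u + differential f x v * β x u)
    = f x * (D u v - D v u) + differential f x u * β x v - β x u * differential f x v
  ring

theorem extDerivOne_differential {f : M → ℝ} (hf : ContMDiff 𝓘(ℝ, E) 𝓘(ℝ) ∞ f)
    (x : M) (u : TangentSpace 𝓘(ℝ, E) x) : extDerivOne (differential f) x u = 0 := by
  set z := extChartAt 𝓘(ℝ, E) x x
  have hsymm : IsSymmSndFDerivAt ℝ (f ∘ (extChartAt 𝓘(ℝ, E) x).symm) z := by
    have hf' : ContDiffAt ℝ ∞ (f ∘ (extChartAt 𝓘(ℝ, E) x).symm) z :=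
      (hf.contMDiffAt.comp z ((contMDiffOn_extChartAt_symm x).contMDiffAt
        (extChartAt_target_mem_nhds x))).contDiffAt
    exact hf'.isSymmSndFDerivAt (by
      rw [minSmoothness_of_isRCLikeNormedField]; exact WithTop.coe_le_coe.2 le_top)
  have h : inChart (differential f) x =ᶠ[𝓝 z] fderiv ℝ (f ∘ (extChartAt 𝓘(ℝ, E) x).symm) := by
    filter_upwards [extChartAt_target_mem_nhds (I := 𝓘(ℝ, E)) x] with w hw
    exact (hasFDerivAt_comp_extChartAt_symm hw (hf.mdifferentiable (by simp) _)).fderiv.symm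
  rw [extDerivOne_eq, h.fderiv_eq]
  refine ContinuousLinearMap.ext fun v : E => ?_
  exact sub_eq_zero.2 (hsymm.eq u v)

/-- A vector field in the preferred chart at `x₀`: its pullback by the inverse of the chart. It is
the counterpart of `inChart` for vector fields. -/
def fieldInChart (X : Π x : M, TangentSpace 𝓘(ℝ, E) x) (x₀ : M) : E → E :=
  mpullback 𝓘(ℝ, E) 𝓘(ℝ, E) (extChartAt 𝓘(ℝ, E) x₀).symm X

omit [IsManifold 𝓘(ℝ, E) ∞ M] in
theorem mpullbackWithin_extChartAt_symm_range (X : Π x : M, TangentSpace 𝓘(ℝ, E) x) (x : M) :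
    mpullbackWithin 𝓘(ℝ, E) 𝓘(ℝ, E) (extChartAt 𝓘(ℝ, E) x).symm X (Set.range 𝓘(ℝ, E)) =
      fieldInChart X x := by
  rw [modelWithCornersSelf_coe, Set.range_id, mpullbackWithin_univ]
  rfl

theorem inChart_fieldInChart (β : Π x : M, Cotangent E x) (X : Π x : M, TangentSpace 𝓘(ℝ, E) x)
    {x : M} {z : E} (hz : z ∈ (extChartAt 𝓘(ℝ, E) x).target) :
    inChart β x z (fieldInChart X x z) =
      β ((extChartAt 𝓘(ℝ, E) x).symm z) (X ((extChartAt 𝓘(ℝ, E) x).symm z)) := by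
  have h := isInvertible_mfderivWithin_extChartAt_symm (I := 𝓘(ℝ, E)) hz
  rw [modelWithCornersSelf_coe, Set.range_id, mfderivWithin_univ] at h
  exact congrArg (β _) (h.self_apply_inverse _)

theorem fieldInChart_extChartAt (X : Π x : M, TangentSpace 𝓘(ℝ, E) x) (x : M) :
    fieldInChart X x (extChartAt 𝓘(ℝ, E) x x) = X x := by
  have h := mfderivWithin_range_extChartAt_symm (I := 𝓘(ℝ, E)) (x := x)
  rw [modelWithCornersSelf_coe, Set.range_id, mfderivWithin_univ] at h
  have h' : ∀ y, y = x → (X y : E) = X x := by rintro y rfl; rfl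
  have hinv : (mfderiv 𝓘(ℝ, E) 𝓘(ℝ, E) (extChartAt 𝓘(ℝ, E) x).symm
      (extChartAt 𝓘(ℝ, E) x x)).inverse = .id ℝ E := by
    rw [h]
    exact ContinuousLinearMap.inverse_id
  exact (congrArg (fun L : E →L[ℝ] E => L (X _)) hinv).trans (h' _ (extChartAt_to_inv x))

theorem differentiableAt_fieldInChart [CompleteSpace E] (hX : MDiffAt (T% X) x) :
    DifferentiableAt ℝ (fieldInChart X x) (extChartAt 𝓘(ℝ, E) x x) := by
  have : IsManifold 𝓘(ℝ, E) 2 M := inferInstance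
  have h := (hX.mdifferentiableWithinAt
    (s := Set.univ)).differentiableWithinAt_mpullbackWithin_vectorField
  rwa [mpullbackWithin_extChartAt_symm_range, Set.preimage_univ, Set.univ_inter,
    modelWithCornersSelf_coe, Set.range_id, differentiableWithinAt_univ] at h

theorem mlieBracket_eq_lieBracket_fieldInChart (X Y : Π x : M, TangentSpace 𝓘(ℝ, E) x) (x : M) :
    mlieBracket 𝓘(ℝ, E) X Y x =
      lieBracket ℝ (fieldInChart X x) (fieldInChart Y x) (extChartAt 𝓘(ℝ, E) x x) := by
  have h : mfderiv 𝓘(ℝ, E) 𝓘(ℝ, E) (extChartAt 𝓘(ℝ, E) x) x = .id ℝ _ := mfderiv_extChartAt_self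
  rw [← mlieBracketWithin_univ, mlieBracketWithin_apply, Set.preimage_univ, Set.univ_inter, h,
    mpullbackWithin_extChartAt_symm_range, mpullbackWithin_extChartAt_symm_range,
    modelWithCornersSelf_coe, Set.range_id, ← lieBracketWithin_univ]
  exact congrArg (fun L : E →L[ℝ] E => L _) ContinuousLinearMap.inverse_id

theorem differential_apply_eq_fderiv (hβ : DifferentiableFormAt β x) (hX : MDiffAt (T% X) x)
    (v : TangentSpace 𝓘(ℝ, E) x) :
    differential (fun y => β y (X y)) x v =
      fderiv ℝ (fun z => inChart β x z (fieldInChart X x z)) (extChartAt 𝓘(ℝ, E) x x) v := by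
  have h := hasFDerivAt_comp_extChartAt_symm (E := E) (mem_extChartAt_target x)
    (by rw [extChartAt_to_inv]; exact hβ.apply hX)
  have hev : (fun z => inChart β x z (fieldInChart X x z)) =ᶠ[𝓝 (extChartAt 𝓘(ℝ, E) x x)]
      (fun y => β y (X y)) ∘ (extChartAt 𝓘(ℝ, E) x).symm := by
    filter_upwards [extChartAt_target_mem_nhds (I := 𝓘(ℝ, E)) x] with z hz
    exact inChart_fieldInChart β X hz
  rw [hev.fderiv_eq, h.fderiv, inChart_extChartAt]
  rfl

theorem extDerivOne_apply_mlieBracket [CompleteSpace E] (hβ : DifferentiableFormAt β x)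
    (hX : MDiffAt (T% X) x) (hY : MDiffAt (T% Y) x) :
    extDerivOne β x (X x) (Y x) = differential (fun y => β y (Y y)) x (X x) -
      differential (fun y => β y (X y)) x (Y x) - β x (mlieBracket 𝓘(ℝ, E) X Y x) := by
  rw [differential_apply_eq_fderiv hβ hX, differential_apply_eq_fderiv hβ hY, extDerivOne_eq,
    mlieBracket_eq_lieBracket_fieldInChart,
    fderiv_clm_apply hβ.differentiableAt_inChart (differentiableAt_fieldInChart hX),
    fderiv_clm_apply hβ.differentiableAt_inChart (differentiableAt_fieldInChart hY),
    ← inChart_extChartAt β x, ← fieldInChart_extChartAt X, ← fieldInChart_extChartAt Y]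
  set B := inChart β x
  set V := fieldInChart X x
  set W := fieldInChart Y x
  set z := extChartAt 𝓘(ℝ, E) x x
  change fderiv ℝ B z (V z) (W z) - fderiv ℝ B z (W z) (V z) =
    (B z (fderiv ℝ W z (V z)) + fderiv ℝ B z (V z) (W z)) -
    (B z (fderiv ℝ V z (W z)) + fderiv ℝ B z (W z) (V z)) -
      B z (fderiv ℝ W z (V z) - fderiv ℝ V z (W z))
  rw [map_sub]
  ring

end DifferentiableForms

section Differential

variable {E : Type*} [NormedAddCommGroup E] [NormedSpace ℝ E]
  {M : Type*} [TopologicalSpace M] [ChartedSpace E M] [IsManifold 𝓘(ℝ, E) ∞ M]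

theorem smoothForm_differential {f : M → ℝ} (hf : ContMDiff 𝓘(ℝ, E) 𝓘(ℝ) ∞ f) :
    SmoothForm (E := E) (differential f) := by
  intro x
  refine (contMDiffAt_hom_bundle _).2 ⟨contMDiffAt_id, ?_⟩
  refine ((hf x).mfderiv_const (m := ∞) (by simp)).congr_of_eventuallyEq (.of_forall fun y => ?_)
  ext v
  simp only [ContinuousLinearMap.inCoordinates, Trivial.fiberBundle_trivializationAt',
    Trivial.continuousLinearMapAt_trivialization, inTangentCoordinates,
    TangentBundle.continuousLinearMapAt_model_space]
  rfl

theorem exists_contMDiff_differential_eq [FiniteDimensional ℝ E] [T2Space M] {x : M}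
    (ξ : Cotangent E x) :
    ∃ f : M → ℝ, ContMDiff 𝓘(ℝ, E) 𝓘(ℝ) ∞ f ∧ differential f x = ξ := by
  obtain ⟨ψ⟩ : Nonempty (SmoothBumpFunction 𝓘(ℝ, E) x) := inferInstance
  let ξ' : E →L[ℝ] ℝ := ξ
  have hf : ContMDiff 𝓘(ℝ, E) 𝓘(ℝ) ∞ fun y => ψ y • ξ' (extChartAt 𝓘(ℝ, E) x y) :=
    ψ.contMDiff_smul (ξ'.contMDiff.comp_contMDiffOn contMDiffOn_extChartAt)
  refine ⟨_, hf, ?_⟩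
  have hξ : (fun y => ψ y • ξ' (extChartAt 𝓘(ℝ, E) x y)) ∘ (extChartAt 𝓘(ℝ, E) x).symm
      =ᶠ[𝓝 (extChartAt 𝓘(ℝ, E) x x)] ξ' := by
    have h1 := (continuousAt_extChartAt_symm (I := 𝓘(ℝ, E)) x).eventually
      (by rw [extChartAt_to_inv]; exact ψ.eventuallyEq_one)
    filter_upwards [h1, extChartAt_target_mem_nhds (I := 𝓘(ℝ, E)) x] with z hz hz'
    rw [Function.comp_apply, hz, (extChartAt 𝓘(ℝ, E) x).right_inv hz', Pi.one_apply, one_smul]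
  have hd := hasFDerivAt_comp_extChartAt_symm (E := E) (mem_extChartAt_target x)
    (hf.mdifferentiable (by simp) _)
  rw [inChart_extChartAt] at hd
  exact hd.unique (ξ'.hasFDerivAt.congr_of_eventuallyEq hξ)

end Differential

section FormBracket

variable {E : Type*} [NormedAddCommGroup E] [NormedSpace ℝ E]
  {M : Type*} [TopologicalSpace M] [ChartedSpace E M]
  {P : Π x : M, Cotangent E x →L[ℝ] TangentSpace 𝓘(ℝ, E) x}
  {α β β' : Π x : M, Cotangent E x} {f : M → ℝ} {x : M}

/-- Skew-symmetry of a bundle map `T*M → TM`, i.e. of the bivector field it represents. -/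
def IsSkew (P : Π x : M, Cotangent E x →L[ℝ] TangentSpace 𝓘(ℝ, E) x) : Prop :=
  ∀ (x : M) (ξ η : Cotangent E x), η (P x ξ) = -ξ (P x η)

theorem IsSkew.differential_apply_swap (hskew : IsSkew P) (α β : Π x : M, Cotangent E x) (x : M) :
    differential (E := E) (fun y => α y (P y (β y))) x =
      -differential (fun y => β y (P y (α y))) x := by
  have h : (fun y => α y (P y (β y))) = -fun y => β y (P y (α y)) :=
    funext fun y => hskew y (β y) (α y)
  rw [h]
  exact mvfderiv_neg

theorem formBracket_eq_of_isSkew (hskew : IsSkew P) (α β : Π x : M, Cotangent E x) (x : M) :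
    formBracket P α β x = extDerivOne β x (P x (α x)) - extDerivOne α x (P x (β x)) +
      differential (fun y => β y (P y (α y))) x := by
  rw [formBracket, lieDeriv, lieDeriv, hskew.differential_apply_swap]
  abel

theorem formBracket_swap (hskew : IsSkew P) (α β : Π x : M, Cotangent E x) (x : M) :
    formBracket P β α x = -formBracket P α β x := by
  rw [formBracket, formBracket, hskew.differential_apply_swap]
  abel

variable [IsManifold 𝓘(ℝ, E) ∞ M]

theorem SmoothBivectorMap.mdifferentiableAt_apply (hP : SmoothBivectorMap P)
    (hβ : DifferentiableFormAt β x) : MDiffAt (T% (fun y => P y (β y))) x :=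
  MDifferentiableAt.clm_bundle_apply ((hP x).mdifferentiableAt (by simp)) hβ

theorem formBracket_differential (hskew : IsSkew P) {f g : M → ℝ}
    (hf : ContMDiff 𝓘(ℝ, E) 𝓘(ℝ) ∞ f) (hg : ContMDiff 𝓘(ℝ, E) 𝓘(ℝ) ∞ g) (x : M) :
    formBracket P (differential f) (differential g) x = differential (poissonBracket P f g) x := by
  rw [formBracket_eq_of_isSkew hskew, extDerivOne_differential hf, extDerivOne_differential hg,
    sub_zero, zero_add]
  rfl

theorem formBracket_add_right (hP : SmoothBivectorMap P) (hskew : IsSkew P)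
    (hα : DifferentiableFormAt α x) (hβ : DifferentiableFormAt β x)
    (hβ' : DifferentiableFormAt β' x) :
    formBracket P α (β + β') x = formBracket P α β x + formBracket P α β' x := by
  have hPα := hP.mdifferentiableAt_apply hα
  have hd : differential (fun y => (β + β') y (P y (α y))) x = _ :=
    mvfderiv_add (hβ.apply hPα) (hβ'.apply hPα)
  rw [formBracket_eq_of_isSkew hskew, formBracket_eq_of_isSkew hskew,
    formBracket_eq_of_isSkew hskew, extDerivOne_add hβ hβ', hd, Pi.add_apply, map_add,
    extDerivOne_map_add]
  simp only [differential]
  abel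

theorem formBracket_smul_right (hP : SmoothBivectorMap P) (hskew : IsSkew P)
    (hα : DifferentiableFormAt α x) (hf : MDiffAt f x) (hβ : DifferentiableFormAt β x) :
    formBracket P α (f • β) x =
      f x • formBracket P α β x + differential f x (P x (α x)) • β x := by
  have hd : differential (fun y => (f • β) y (P y (α y))) x = _ :=
    mvfderiv_mul hf (hβ.apply (hP.mdifferentiableAt_apply hα))
  rw [formBracket_eq_of_isSkew hskew, formBracket_eq_of_isSkew hskew, extDerivOne_smul hf hβ, hd,
    Pi.smul_apply', map_smul, extDerivOne_map_smul]
  simp only [differential]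
  module

end FormBracket

section Tensoriality

variable {E : Type*} [NormedAddCommGroup E] [NormedSpace ℝ E]
  {M : Type*} [TopologicalSpace M] [ChartedSpace E M]

theorem tensorialAt_neg {F : Type*} [NormedAddCommGroup F] [NormedSpace ℝ F] {V : M → Type*}
    [TopologicalSpace (TotalSpace F V)] [∀ x, AddCommGroup (V x)] [∀ x, Module ℝ (V x)]
    [∀ x, TopologicalSpace (V x)] [FiberBundle F V] {A : Type*} [AddCommGroup A] [Module ℝ A]
    {Φ : (Π x, V x) → A} {x : M} (hΦ : TensorialAt 𝓘(ℝ, E) F Φ x) :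
    TensorialAt 𝓘(ℝ, E) F (-Φ) x where
  smul hf hσ := by rw [Pi.neg_apply, hΦ.smul hf hσ, Pi.neg_apply, smul_neg]
  add hσ hσ' := by rw [Pi.neg_apply, hΦ.add hσ hσ', neg_add, Pi.neg_apply, Pi.neg_apply]

theorem eq_of_swap_of_tensorialAt {F : Type*} [NormedAddCommGroup F] [NormedSpace ℝ F]
    [FiniteDimensional ℝ F] {V : M → Type*}
    [TopologicalSpace (TotalSpace F V)] [∀ x, AddCommGroup (V x)] [∀ x, Module ℝ (V x)]
    [∀ x, TopologicalSpace (V x)] [FiberBundle F V] [VectorBundle ℝ F V]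
    [ContMDiffVectorBundle 1 F V 𝓘(ℝ, E)] {A : Type*} [AddCommGroup A] [Module ℝ A]
    {Φ : (Π x, V x) → (Π x, V x) → A} {x : M} (hswap : ∀ σ τ, Φ τ σ = -Φ σ τ)
    (hΦ : ∀ σ, MDiffAt (T% σ) x → TensorialAt 𝓘(ℝ, E) F (Φ σ) x) {σ σ' τ τ' : Π x, V x}
    (hσ : MDiffAt (T% σ) x) (hσ' : MDiffAt (T% σ') x) (hτ : MDiffAt (T% τ) x)
    (hτ' : MDiffAt (T% τ') x) (hσσ' : σ x = σ' x) (hττ' : τ x = τ' x) : Φ σ τ = Φ σ' τ' := by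
  refine TensorialAt.pointwise₂ (fun τ hτ => ?_) hΦ hσ hσ' hτ hτ' hσσ' hττ'
  have h : (Φ · τ) = -Φ τ := funext fun σ => hswap τ σ
  exact h ▸ tensorialAt_neg (hΦ τ hτ)

end Tensoriality

section FieldTorsion

variable {E : Type*} [NormedAddCommGroup E] [NormedSpace ℝ E]
  {M : Type*} [TopologicalSpace M] [ChartedSpace E M] [IsManifold 𝓘(ℝ, E) ∞ M]
  {A : Π x : M, TangentSpace 𝓘(ℝ, E) x →L[ℝ] TangentSpace 𝓘(ℝ, E) x}
  {X : Π x : M, TangentSpace 𝓘(ℝ, E) x} {x : M}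

theorem SmoothEndTangent.mdifferentiableAt_apply (hA : SmoothEndTangent A)
    (hX : MDiffAt (T% X) x) : MDiffAt (T% (fun y => A y (X y))) x :=
  MDifferentiableAt.clm_bundle_apply ((hA x).mdifferentiableAt (by simp)) hX

omit [IsManifold 𝓘(ℝ, E) ∞ M] in
theorem nijenhuisTorsion_mlieBracket_swap
    (A : Π x : M, TangentSpace 𝓘(ℝ, E) x →L[ℝ] TangentSpace 𝓘(ℝ, E) x)
    (X Y : Π x : M, TangentSpace 𝓘(ℝ, E) x) (x : M) :
    nijenhuisTorsion (mlieBracket 𝓘(ℝ, E)) A Y X x =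
      -nijenhuisTorsion (mlieBracket 𝓘(ℝ, E)) A X Y x := by
  simp only [nijenhuisTorsion, deformedBracket]
  rw [mlieBracket_swap_apply, mlieBracket_swap_apply (V := fun y => A y (Y y)),
    mlieBracket_swap_apply (V := Y), mlieBracket_swap_apply (V := Y) (W := X)]
  simp only [map_neg, map_sub, map_add]
  abel

theorem tensorialAt_nijenhuisTorsion_mlieBracket [CompleteSpace E] (hA : SmoothEndTangent A)
    (X : Π x : M, TangentSpace 𝓘(ℝ, E) x) (x : M) :
    TensorialAt 𝓘(ℝ, E) E (nijenhuisTorsion (mlieBracket 𝓘(ℝ, E)) A X · x) x where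
  smul {f Y} hf hY := by
    have hAfY : (fun y => A y ((f • Y) y)) = f • fun y => A y (Y y) :=
      funext fun y => map_smul (A y) (f y) (Y y)
    simp only [nijenhuisTorsion, deformedBracket]
    rw [hAfY, mlieBracket_smul_right hf hY, mlieBracket_smul_right hf hY,
      mlieBracket_smul_right hf (hA.mdifferentiableAt_apply hY),
      mlieBracket_smul_right hf (hA.mdifferentiableAt_apply hY)]
    simp only [map_add, map_sub, map_smul]
    module
  add {Y Y'} hY hY' := by
    have hAYY' : (fun y => A y ((Y + Y') y)) = (fun y => A y (Y y)) + fun y => A y (Y' y) :=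
      funext fun y => map_add (A y) (Y y) (Y' y)
    simp only [nijenhuisTorsion, deformedBracket]
    rw [hAYY', mlieBracket_add_right hY hY', mlieBracket_add_right hY hY',
      mlieBracket_add_right (hA.mdifferentiableAt_apply hY) (hA.mdifferentiableAt_apply hY'),
      mlieBracket_add_right (hA.mdifferentiableAt_apply hY) (hA.mdifferentiableAt_apply hY')]
    simp only [map_add, map_sub]
    abel

end FieldTorsion

section Morphism

variable {E : Type*} [NormedAddCommGroup E] [NormedSpace ℝ E]
  {M : Type*} [TopologicalSpace M] [ChartedSpace E M]
  {P : Π x : M, Cotangent E x →L[ℝ] TangentSpace 𝓘(ℝ, E) x}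
  {α β : Π x : M, Cotangent E x} {x : M}

theorem poissonBracket_swap (hskew : IsSkew P) (f g : M → ℝ) :
    poissonBracket P g f = -poissonBracket P f g :=
  funext fun x => hskew x (differential g x) (differential f x)

theorem poissonBracket_neg_right (P : Π x : M, Cotangent E x →L[ℝ] TangentSpace 𝓘(ℝ, E) x)
    (f g : M → ℝ) : poissonBracket P f (-g) = -poissonBracket P f g :=
  funext fun x => congrArg (fun ξ : Cotangent E x => ξ (P x (differential f x))) mvfderiv_neg

/-- The failure `P [α, β]^P - [P α, P β]` of `P` to be a morphism from the bracket of 1-forms to the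
Lie bracket of vector fields. -/
def morphismDefect (P : Π x : M, Cotangent E x →L[ℝ] TangentSpace 𝓘(ℝ, E) x)
    (α β : Π x : M, Cotangent E x) (x : M) : TangentSpace 𝓘(ℝ, E) x :=
  P x (formBracket P α β x) - mlieBracket 𝓘(ℝ, E) (fun y => P y (α y)) (fun y => P y (β y)) x

theorem morphismDefect_swap (hskew : IsSkew P) (α β : Π x : M, Cotangent E x) (x : M) :
    morphismDefect P β α x = -morphismDefect P α β x := by
  rw [morphismDefect, morphismDefect, formBracket_swap hskew,
    mlieBracket_swap_apply (V := fun y => P y (β y)), map_neg, neg_sub_neg, neg_sub]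

variable [IsManifold 𝓘(ℝ, E) ∞ M]

theorem IsPoisson.poissonBracket_poissonBracket_left (hP : IsPoisson P) {f g h : M → ℝ}
    (hf : ContMDiff 𝓘(ℝ, E) 𝓘(ℝ) ∞ f) (hg : ContMDiff 𝓘(ℝ, E) 𝓘(ℝ) ∞ g)
    (hh : ContMDiff 𝓘(ℝ, E) 𝓘(ℝ) ∞ h) (x : M) :
    poissonBracket P (poissonBracket P f g) h x =
      poissonBracket P f (poissonBracket P g h) x -
        poissonBracket P g (poissonBracket P f h) x := by
  have hj := hP.jacobi f g h hf hg hh x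
  rw [poissonBracket_swap hP.skew f h, poissonBracket_neg_right,
    poissonBracket_swap hP.skew (poissonBracket P f g) h, Pi.neg_apply, Pi.neg_apply] at hj
  linarith

theorem tensorialAt_morphismDefect [CompleteSpace E] (hP : SmoothBivectorMap P) (hskew : IsSkew P)
    (hα : DifferentiableFormAt α x) :
    TensorialAt 𝓘(ℝ, E) (E →L[ℝ] ℝ) (V := fun y : M => Cotangent E y)
      (morphismDefect P α · x) x where
  smul {f β} hf hβ := by
    have hPfβ : (fun y => P y ((f • β) y)) = f • fun y => P y (β y) :=
      funext fun y => map_smul (P y) (f y) (β y)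
    simp only [morphismDefect]
    rw [hPfβ, formBracket_smul_right hP hskew hα hf hβ,
      mlieBracket_smul_right hf (hP.mdifferentiableAt_apply hβ)]
    simp only [map_add, map_smul, differential]
    module
  add {β β'} hβ hβ' := by
    have hPββ' : (fun y => P y ((β + β') y)) = (fun y => P y (β y)) + fun y => P y (β' y) :=
      funext fun y => map_add (P y) (β y) (β' y)
    simp only [morphismDefect]
    rw [hPββ', formBracket_add_right hP hskew hα hβ hβ',
      mlieBracket_add_right (hP.mdifferentiableAt_apply hβ) (hP.mdifferentiableAt_apply hβ'),
      map_add]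
    abel

theorem differential_apply_mlieBracket [CompleteSpace E]
    {X Y : Π x : M, TangentSpace 𝓘(ℝ, E) x} {f : M → ℝ} (hf : ContMDiff 𝓘(ℝ, E) 𝓘(ℝ) ∞ f)
    (hX : MDiffAt (T% X) x) (hY : MDiffAt (T% Y) x) :
    differential f x (mlieBracket 𝓘(ℝ, E) X Y x) =
      differential (fun y => differential f y (Y y)) x (X x) -
        differential (fun y => differential f y (X y)) x (Y x) := by
  have h :=
    extDerivOne_apply_mlieBracket ((smoothForm_differential hf).differentiableFormAt x) hX hY
  rw [extDerivOne_differential hf, zero_apply] at h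
  linarith

theorem IsPoisson.morphismDefect_differential [FiniteDimensional ℝ E] [T2Space M]
    (hP : IsPoisson P) {f g : M → ℝ}
    (hf : ContMDiff 𝓘(ℝ, E) 𝓘(ℝ) ∞ f) (hg : ContMDiff 𝓘(ℝ, E) 𝓘(ℝ) ∞ g) (x : M) :
    morphismDefect P (differential f) (differential g) x = 0 := by
  have : CompleteSpace E := FiniteDimensional.complete ℝ E
  have hPd : ∀ {f : M → ℝ}, ContMDiff 𝓘(ℝ, E) 𝓘(ℝ) ∞ f →
      MDiffAt (T% fun y => P y (differential f y)) x := fun hf =>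
    hP.smooth.mdifferentiableAt_apply ((smoothForm_differential hf).differentiableFormAt x)
  have hcotangent : ∀ ξ : Cotangent E x,
      ξ (morphismDefect P (differential f) (differential g) x) = 0 := by
    intro ξ
    obtain ⟨h, hh, rfl⟩ := exists_contMDiff_differential_eq ξ
    rw [morphismDefect, map_sub, sub_eq_zero, formBracket_differential hP.skew hf hg,
      differential_apply_mlieBracket hh (hPd hf) (hPd hg)]
    exact hP.poissonBracket_poissonBracket_left hf hg hh x
  exact SeparatingDual.eq_zero_of_forall_dual_eq_zero (R := ℝ) (V := E) hcotangent

theorem IsPoisson.apply_formBracket [FiniteDimensional ℝ E] [T2Space M] (hP : IsPoisson P)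
    (hα : DifferentiableFormAt α x) (hβ : DifferentiableFormAt β x) :
    P x (formBracket P α β x) =
      mlieBracket 𝓘(ℝ, E) (fun y => P y (α y)) (fun y => P y (β y)) x := by
  have : CompleteSpace E := FiniteDimensional.complete ℝ E
  obtain ⟨f, hf, hfα⟩ := exists_contMDiff_differential_eq (α x)
  obtain ⟨g, hg, hgβ⟩ := exists_contMDiff_differential_eq (β x)
  refine sub_eq_zero.1 (Eq.trans ?_ (hP.morphismDefect_differential hf hg x))
  exact eq_of_swap_of_tensorialAt (V := fun y : M => Cotangent E y) (F := E →L[ℝ] ℝ)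
    (Φ := (morphismDefect P · · x)) (morphismDefect_swap hP.skew · · x)
    (fun σ hσ => tensorialAt_morphismDefect hP.smooth hP.skew hσ) hα
    ((smoothForm_differential hf).differentiableFormAt x) hβ
    ((smoothForm_differential hg).differentiableFormAt x) hfα.symm hgβ.symm

end Morphism

section Intertwining

variable {M : Type*} {V W : M → Type*} [∀ x, TopologicalSpace (V x)] [∀ x, AddCommGroup (V x)]
  [∀ x, Module ℝ (V x)] [∀ x, TopologicalSpace (W x)] [∀ x, AddCommGroup (W x)]
  [∀ x, Module ℝ (W x)]

theorem map_nijenhuisTorsion {μ : (Π x, V x) → (Π x, V x) → Π x, V x}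
    {ν : (Π x, W x) → (Π x, W x) → Π x, W x} {P : Π x, V x →L[ℝ] W x} {N : Π x, V x →L[ℝ] V x}
    {A : Π x, W x →L[ℝ] W x} {S : (Π x, V x) → Prop}
    (hμν : ∀ s t, S s → S t → ∀ x,
      P x (μ s t x) = ν (fun y => P y (s y)) (fun y => P y (t y)) x)
    (hN : ∀ s, S s → S fun y => N y (s y)) (hPN : ∀ x, (P x).comp (N x) = (A x).comp (P x))
    {s t : Π x, V x} (hs : S s) (ht : S t) (x : M) :
    P x (nijenhuisTorsion μ N s t x) =
      nijenhuisTorsion ν A (fun y => P y (s y)) (fun y => P y (t y)) x := by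
  have hPN' : ∀ y v, P y (N y v) = A y (P y v) := fun y => DFunLike.congr_fun (hPN y)
  simp only [nijenhuisTorsion, deformedBracket, map_sub, map_add, hPN',
    hμν _ _ (hN _ hs) (hN _ ht), hμν _ _ (hN _ hs) ht, hμν _ _ hs (hN _ ht), hμν _ _ hs ht]

end Intertwining

section ImageTorsion

variable {E : Type*} [NormedAddCommGroup E] [NormedSpace ℝ E]
  {M : Type*} [TopologicalSpace M] [ChartedSpace E M] [IsManifold 𝓘(ℝ, E) ∞ M]
  {P : Π x : M, Cotangent E x →L[ℝ] TangentSpace 𝓘(ℝ, E) x}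
  {N : Π x : M, Cotangent E x →L[ℝ] Cotangent E x}
  {A : Π x : M, TangentSpace 𝓘(ℝ, E) x →L[ℝ] TangentSpace 𝓘(ℝ, E) x}

theorem SmoothEndCotangent.smoothForm_apply (hN : SmoothEndCotangent N)
    {α : Π x : M, Cotangent E x} (hα : SmoothForm α) : SmoothForm fun y => N y (α y) :=
  ContMDiff.clm_bundle_apply hN hα

variable [FiniteDimensional ℝ E] [T2Space M]

theorem IsPoisson.nijenhuisTorsion_mlieBracket_apply (hP : IsPoisson P)
    (hN : IsNijenhuisForForms P N) (hPN : ∀ x, (P x).comp (N x) = (A x).comp (P x))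
    {α β : Π x : M, Cotangent E x} (hα : SmoothForm α) (hβ : SmoothForm β) (x : M) :
    nijenhuisTorsion (mlieBracket 𝓘(ℝ, E)) A (fun y => P y (α y)) (fun y => P y (β y)) x = 0 := by
  rw [← map_nijenhuisTorsion (μ := formBracket P) (S := SmoothForm)
    (fun α β hα hβ x =>
      hP.apply_formBracket (hα.differentiableFormAt x) (hβ.differentiableFormAt x))
    (fun α => hN.1.smoothForm_apply) hPN hα hβ x, hN.2 α β hα hβ x, map_zero]

theorem IsPoisson.nijenhuisTorsion_mlieBracket_eq_zero (hP : IsPoisson P)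
    (hN : IsNijenhuisForForms P N) (hA : SmoothEndTangent A)
    (hPN : ∀ x, (P x).comp (N x) = (A x).comp (P x)) {X Y : Π x : M, TangentSpace 𝓘(ℝ, E) x}
    {x : M} (hX : MDiffAt (T% X) x) (hY : MDiffAt (T% Y) x) (hXP : X x ∈ Set.range (P x))
    (hYP : Y x ∈ Set.range (P x)) : nijenhuisTorsion (mlieBracket 𝓘(ℝ, E)) A X Y x = 0 := by
  have : CompleteSpace E := FiniteDimensional.complete ℝ E
  obtain ⟨ξ, hξ⟩ := hXP
  obtain ⟨η, hη⟩ := hYP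
  obtain ⟨f, hf, rfl⟩ := exists_contMDiff_differential_eq ξ
  obtain ⟨g, hg, rfl⟩ := exists_contMDiff_differential_eq η
  have hdf := smoothForm_differential hf
  have hdg := smoothForm_differential hg
  refine Eq.trans ?_ (hP.nijenhuisTorsion_mlieBracket_apply hN hPN hdf hdg x)
  exact eq_of_swap_of_tensorialAt (Φ := (nijenhuisTorsion (mlieBracket 𝓘(ℝ, E)) A · · x))
    (nijenhuisTorsion_mlieBracket_swap A · · x)
    (fun X _ => tensorialAt_nijenhuisTorsion_mlieBracket hA X x)
    hX (hP.smooth.mdifferentiableAt_apply (hdf.differentiableFormAt x))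
    hY (hP.smooth.mdifferentiableAt_apply (hdg.differentiableFormAt x)) hξ.symm hη.symm

end ImageTorsion

section CotangentBundle

variable {E : Type*} [NormedAddCommGroup E] [NormedSpace ℝ E]
  {M : Type*} [TopologicalSpace M] [ChartedSpace E M] [IsManifold 𝓘(ℝ, E) ∞ M]

theorem symm_trivializationAt_cotangent {x y : M} (hy : y ∈ (chartAt E x).source)
    (φ : E →L[ℝ] ℝ) :
    (trivializationAt (E →L[ℝ] ℝ) (Cotangent (M := M) E) x).symm y φ =
      φ.comp ((trivializationAt E (TangentSpace 𝓘(ℝ, E)) x).continuousLinearMapAt ℝ y) := by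
  refine (Pretrivialization.continuousLinearMap_symm_apply' (RingHom.id ℝ)
    (e₁ := trivializationAt E (TangentSpace 𝓘(ℝ, E)) x)
    (e₂ := trivializationAt ℝ (Bundle.Trivial M ℝ) x) (b := y) ⟨hy, trivial⟩ φ).trans ?_
  ext v
  simp

theorem inCoordinates_cotangent_apply {x y : M} (hy : y ∈ (chartAt E x).source)
    (B : Cotangent E y →L[ℝ] Cotangent E y) (φ : E →L[ℝ] ℝ) (v : E) :
    ContinuousLinearMap.inCoordinates (E →L[ℝ] ℝ) (Cotangent E) (E →L[ℝ] ℝ) (Cotangent E)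
      x y x y B φ v =
    B (φ.comp ((trivializationAt E (TangentSpace 𝓘(ℝ, E)) x).continuousLinearMapAt ℝ y))
      ((trivializationAt E (TangentSpace 𝓘(ℝ, E)) x).symmL ℝ y v) := by
  have hC : y ∈ (trivializationAt (E →L[ℝ] ℝ) (Cotangent (M := M) E) x).baseSet :=
    ⟨hy, trivial⟩
  refine (inCoordinates_apply_eq₂ (F₃ := ℝ) (E₂ := TangentSpace 𝓘(ℝ, E))
    (E₃ := Bundle.Trivial M ℝ) (ϕ := B) hC hy trivial).trans ?_
  rw [symm_trivializationAt_cotangent hy, ← Trivialization.symmL_apply (R := ℝ) _ hy]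
  simp

end CotangentBundle

section Transpose

theorem contDiff_of_isLinearMap {𝕜 F G : Type*} [NontriviallyNormedField 𝕜] [CompleteSpace 𝕜]
    [NormedAddCommGroup F] [NormedSpace 𝕜 F] [FiniteDimensional 𝕜 F] [NormedAddCommGroup G]
    [NormedSpace 𝕜 G] {n : WithTop ℕ∞} {f : F → G} (hf : IsLinearMap 𝕜 f) : ContDiff 𝕜 n f :=
  (LinearMap.toContinuousLinearMap hf.mk').contDiff

variable {E : Type*} [NormedAddCommGroup E] [NormedSpace ℝ E] [FiniteDimensional ℝ E]

theorem eq_transposeCLM {A : E →L[ℝ] E} {B : (E →L[ℝ] ℝ) →L[ℝ] (E →L[ℝ] ℝ)}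
    (h : ∀ (φ : E →L[ℝ] ℝ) (v : E), φ (A v) = B φ v) : A = transposeCLM B :=
  (existsUnique_transpose B).unique h (apply_transposeCLM B)

theorem isLinearMap_transposeCLM : IsLinearMap ℝ (transposeCLM (E := E)) where
  map_add _ _ := (eq_transposeCLM fun φ v => by simp [apply_transposeCLM]).symm
  map_smul _ _ := (eq_transposeCLM fun φ v => by simp [apply_transposeCLM]).symm

theorem contDiff_transposeCLM : ContDiff ℝ ∞ (transposeCLM (E := E)) :=
  contDiff_of_isLinearMap isLinearMap_transposeCLM

variable {M : Type*} [TopologicalSpace M] [ChartedSpace E M]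

theorem dualBundleMap_transposeBundleMap (N : Π x : M, Cotangent E x →L[ℝ] Cotangent E x) :
    dualBundleMap (transposeBundleMap N) = N :=
  funext fun x => ContinuousLinearMap.ext fun φ => ContinuousLinearMap.ext fun v =>
    apply_transposeCLM (E := E) (N x) φ v

variable [IsManifold 𝓘(ℝ, E) ∞ M]

theorem inCoordinates_transposeBundleMap (N : Π x : M, Cotangent E x →L[ℝ] Cotangent E x)
    {x y : M} (hy : y ∈ (chartAt E x).source) :
    ContinuousLinearMap.inCoordinates E (TangentSpace 𝓘(ℝ, E)) E (TangentSpace 𝓘(ℝ, E)) x y x y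
      (transposeBundleMap N y) =
    transposeCLM (ContinuousLinearMap.inCoordinates (E →L[ℝ] ℝ) (Cotangent E) (E →L[ℝ] ℝ)
      (Cotangent E) x y x y (N y)) := by
  refine eq_transposeCLM fun φ v => ?_
  rw [inCoordinates_cotangent_apply hy]
  exact apply_transposeCLM (E := E) (N y)
    (φ.comp ((trivializationAt E (TangentSpace 𝓘(ℝ, E)) x).continuousLinearMapAt ℝ y))
    ((trivializationAt E (TangentSpace 𝓘(ℝ, E)) x).symmL ℝ y v)

theorem smoothEndTangent_transposeBundleMap
    {N : Π x : M, Cotangent E x →L[ℝ] Cotangent E x} (hN : SmoothEndCotangent N) :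
    SmoothEndTangent (transposeBundleMap N) := by
  intro x
  refine (contMDiffAt_hom_bundle _).2 ⟨contMDiffAt_id, ?_⟩
  refine ((contDiff_transposeCLM (E := E)).contMDiff.contMDiffAt.comp x
    ((contMDiffAt_hom_bundle _).1 (hN x)).2).congr_of_eventuallyEq ?_
  filter_upwards [chart_source_mem_nhds E x] with y hy
  exact inCoordinates_transposeBundleMap N hy

end Transpose

end PoissonContraction

end

open PoissonContraction in
theorem theorem15_general {E : Type*} [NormedAddCommGroup E] [NormedSpace ℝ E]
    [FiniteDimensional ℝ E] {M : Type*} [TopologicalSpace M] [T2Space M] [ChartedSpace E M]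
    [IsManifold 𝓘(ℝ, E) ∞ M] {P : Π x : M, Cotangent E x →L[ℝ] TangentSpace 𝓘(ℝ, E) x}
    (hP : IsPoisson P) {N : Π x : M, Cotangent E x →L[ℝ] Cotangent E x}
    (hN : IsNijenhuisForForms P N)
    {A : Π x : M, TangentSpace 𝓘(ℝ, E) x →L[ℝ] TangentSpace 𝓘(ℝ, E) x}
    (hA : SmoothEndTangent A) (hPN : ∀ x, (P x).comp (N x) = (A x).comp (P x)) :
    (∀ (X Y : Π x : M, TangentSpace 𝓘(ℝ, E) x) (x : M), MDiffAt (T% X) x → MDiffAt (T% Y) x →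
      X x ∈ Set.range (P x) → Y x ∈ Set.range (P x) →
      nijenhuisTorsion (mlieBracket 𝓘(ℝ, E)) A X Y x = 0) ∧
    ((∀ x, Function.Surjective (P x)) → dualBundleMap A = N →
      (∀ α β : Π x : M, Cotangent E x, SmoothForm α → SmoothForm β → ∀ x,
        deformedBracket (formBracket P) N α β x =
          formBracket (fun y => (P y).comp (N y)) α β x) →
      IsPoissonNijenhuis P A) := by
  have torsion_eq_zero := fun (X Y : Π x : M, TangentSpace 𝓘(ℝ, E) x) (x : M) =>
    hP.nijenhuisTorsion_mlieBracket_eq_zero hN hA hPN (X := X) (Y := Y) (x := x)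
  refine ⟨torsion_eq_zero, fun hsurj hAN hcontr => ⟨hP, ⟨hA, fun X Y hX hY x => ?_⟩, ?_, ?_⟩⟩
  · exact torsion_eq_zero X Y x (hX.mdifferentiableAt x) (hY.mdifferentiableAt x)
      (hsurj x (X x)) (hsurj x (Y x))
  · exact fun x => hAN ▸ (hPN x).symm
  · intro α β hα hβ x
    simp only [← hPN, hAN, hcontr α β hα hβ x, sub_self]

theorem theorem15 {E : Type*} [NormedAddCommGroup E] [NormedSpace ℝ E] [FiniteDimensional ℝ E]
    {M : Type*} [TopologicalSpace M] [T2Space M] [ChartedSpace E M] [IsManifold 𝓘(ℝ, E) ∞ M]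
    (P : Π x : M, PoissonContraction.Cotangent E x →L[ℝ] TangentSpace 𝓘(ℝ, E) x)
    (hP : PoissonContraction.IsPoisson P)
    (N : Π x : M, PoissonContraction.Cotangent E x →L[ℝ] PoissonContraction.Cotangent E x)
    (hN : PoissonContraction.IsNijenhuisForForms P N)
    (hcomm : ∀ x : M,
      (P x).comp (N x) = (PoissonContraction.transposeBundleMap N x).comp (P x)) :
    (∀ X Y : Π x : M, TangentSpace 𝓘(ℝ, E) x,
      PoissonContraction.SmoothField X → PoissonContraction.SmoothField Y →
      (∀ x, X x ∈ Set.range (P x)) → (∀ x, Y x ∈ Set.range (P x)) →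
      ∀ x, PoissonContraction.nijenhuisTorsion (mlieBracket 𝓘(ℝ, E))
        (PoissonContraction.transposeBundleMap N) X Y x = 0) ∧
    ((∀ x, Function.Bijective (P x)) →
      (∀ α β : Π x : M, PoissonContraction.Cotangent E x,
        PoissonContraction.SmoothForm α → PoissonContraction.SmoothForm β →
        ∀ x, PoissonContraction.deformedBracket (PoissonContraction.formBracket P) N α β x =
          PoissonContraction.formBracket (fun y => (P y).comp (N y)) α β x) →
      PoissonContraction.IsPoissonNijenhuis P (PoissonContraction.transposeBundleMap N)) := by
  have ⟨h₁, h₂⟩ := theorem15_general hP hN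
    (PoissonContraction.smoothEndTangent_transposeBundleMap hN.1) hcomm
  exact ⟨fun X Y hX hY hXP hYP x =>
      h₁ X Y x (hX.mdifferentiableAt x) (hY.mdifferentiableAt x) (hXP x) (hYP x),
    fun hP' => h₂ (fun x => (hP' x).surjective)
      (PoissonContraction.dualBundleMap_transposeBundleMap N)⟩
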